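/- Let $S^2=\mathbb C\cup\{\infty\}$ with stereographic coordinate $z$, let $N=\{z=\infty\}$, $S=\{z=0\}$, $w=1/z$, and let $\nu=\frac{1}{\pi}(1+|z|^2)^{-2}\,dx\,dy$ be the area measure of total mass $1$. For $d\in\mathbb Z$ the holomorphic line bundle of degree $d$ has canonical holomorphic frames $\zeta$ over $S^2-\{N\}$ and $\zeta_S$ over $S^2-\{S\}$ with $\zeta=w^{d}\zeta_S$. Let $L_1,L_2$ be holomorphic line bundles on $S^2$ with canonical frames $\zeta_1,\zeta_2$ over $S^2-\{N\}$, and suppose that $L=L_2\otimes L_1^*$ has degree $k=\deg L_2-\deg L_1\ge 2$, with canonical frame $\zeta_L$. Let $H$ be a smooth hermitian metric on $L$, let $g$ be a polynomial in $z$ of degree at most $k-2$, and let $\eta=\bar g\,\zeta_L^{*H}\,d\bar z=\bar g\,|\zeta_L|_H^2\,\zeta_{L^*}\,d\bar z$ be the corresponding $H$-antiholomorphic $(0,1)$-form with values in $L^*=\mathrm{Hom}(L_2,L_1)$, where $\zeta_{L^*}$ is the frame dual to $\zeta_L$. Let $E=L_1\oplus L_2$ (as a smooth bundle) carry the holomorphic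 structure $$D''_\eta=\begin{pmatrix}D_1''&\eta\\0&D_2''\end{pmatrix}.$$ Let $f\in C^\infty(S^2,\mathbb C)$ be the function with $\partial f/\partial\bar z=-\bar g\,|\zeta_L|_H^2$ on $S^2-\{N\}$ and $f(N)=0$, and put $$b_j=\int_{S^2}\frac{|\eta|_H^2}{g}\,w^{-j+1}\,\nu\qquad(1\le j\le k-1),$$ where $|\eta|_H^2=|g|^2|\zeta_L|_H^2|dz|^2$ and $|dz|^2=(1+|z|^2)^2$ (the integrand being read as $\bar g\,|\zeta_L|_H^2|dz|^2w^{-j+1}$ where $g=0$). Let $h=\dfrac{y(w)}{1-v(w)}$, where $y,v$ are complex polynomials with $y(0)=v(0)=0$ such that $y$ and $1-v$ have no common zeros, and let $s^-$ be the number of poles of $h$ in $S^2-\{N\}$, counted with multiplicity. For a polynomial $p(w)$ let $p_j$ be the coefficient of $w^j$. Let $j^*\le k$ be the largest integer such that the equations $$b_j=\sum_{m=0}^{j-1}(y\,v^m)_j$$ hold for all $j$ with $1\le j<j^*$. Then $\tilde\psi=((f+h)\zeta_1,\zeta_2)$ is a meromorphic section of $E$ and $$\deg\tilde\psi=\deg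 L_1+j^*-s^-,$$ where the order of a meromorphic section at $x$ is the integer $m$ for which the section is, near $x$, the $m$-th power of a local coordinate vanishing at $x$ times a non-vanishing holomorphic local section, and its degree is the sum of its orders. -/

import Mathlib

noncomputable section

namespace SphereExt

open scoped Topology ContDiff Polynomial ComplexConjugate
open Filter MeasureTheory

/-! The sphere `S²` is `ℂ ∪ {∞} = OnePoint ℂ` through the stereographic coordinate `z`; the north
pole `N` is `∞`, the south pole `S` is `z = 0`, and `w = 1 / z` is the coordinate on `S² - {S}`. -/

/-- The north pole. -/
def north : OnePoint ℂ := OnePoint.infty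

/-- The point of `S² - {S}` with coordinate `w`. -/
def ofW (w : ℂ) : OnePoint ℂ := if w = 0 then north else ((w⁻¹ : ℂ) : OnePoint ℂ)

/-- `f ∈ C^∞(S²)`, read in the two coordinates `z` and `w`. -/
def SmoothOnSphere (f : OnePoint ℂ → ℂ) : Prop :=
  ContDiff ℝ ∞ (fun z : ℂ => f (z : OnePoint ℂ)) ∧ ContDiff ℝ ∞ (fun w : ℂ => f (ofW w))

/-- The Wirtinger derivative `∂F/∂ū = (∂F/∂x + i ∂F/∂y) / 2`. -/
def dbar {V : Type*} [NormedAddCommGroup V] [NormedSpace ℂ V] [NormedSpace ℝ V]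
    (F : ℂ → V) (u : ℂ) : V :=
  (1 / 2 : ℂ) • (fderiv ℝ F u 1 + Complex.I • fderiv ℝ F u Complex.I)

/-- The area measure `ν` of `S²`, of total mass one, in the coordinate `z` of `S² - {N}`. -/
def area : Measure ℂ :=
  volume.withDensity fun z => ENNReal.ofReal (1 / (Real.pi * (1 + ‖z‖ ^ 2) ^ 2))

/-! ### Holomorphic vector bundles, meromorphic sections, degrees -/

/-- A complex vector bundle on `S²` with a holomorphic structure `D''`, given in a frame over
`S² - {N}` and a frame over `S² - {S}`: a section with coefficient vector `s z` in the first frame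
has coefficient vector `trans w *ᵥ s w⁻¹` in the second, and `D''` is `∂̄ + connN dz̄` in the first
frame and `∂̄ + connS dw̄` in the second. -/
structure HolBundle (ι : Type) [Fintype ι] [DecidableEq ι] where
  trans : ℂ → Matrix ι ι ℂ
  connN : ℂ → Matrix ι ι ℂ
  connS : ℂ → Matrix ι ι ℂ
  trans_holo : ∀ i j, DifferentiableOn ℂ (fun w => trans w i j) {0}ᶜ
  trans_unit : ∀ w, w ≠ 0 → IsUnit (trans w)
  connN_smooth : ∀ i j, ContDiff ℝ ∞ fun z => connN z i j
  connS_smooth : ∀ i j, ContDiff ℝ ∞ fun w => connS w i j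
  compat : ∀ w, w ≠ 0 →
    connS w * trans w = (-(conj w) ^ (-2 : ℤ)) • (trans w * connN w⁻¹)

/-- In a frame where `D'' = ∂̄ + A dū`, the coefficient vector `σ` is that of a smooth local section
with `D'' σ = 0` in a neighbourhood of `a`. -/
def HolomorphicNear {ι : Type} [Fintype ι] (A : ℂ → Matrix ι ι ℂ) (σ : ℂ → ι → ℂ) (a : ℂ) : Prop :=
  ∀ᶠ u in 𝓝 a, ContDiffAt ℝ ∞ σ u ∧ dbar σ u + (A u).mulVec (σ u) = 0

namespace HolBundle

variable {ι : Type} [Fintype ι] [DecidableEq ι]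

/-- The section with coefficient vector `s` in the frame over `S² - {N}` has order `m` at `x`:
in a punctured neighbourhood of `x` it is the `m`-th power of a coordinate vanishing at `x` times a
holomorphic local section of `E` that does not vanish at `x`. (Only values near but off `x` enter;
in particular the value of the section at `N` plays no role.) -/
def HasOrderAt (E : HolBundle ι) (s : ℂ → ι → ℂ) (x : OnePoint ℂ) (m : ℤ) : Prop :=
  (∀ a : ℂ, x = (a : OnePoint ℂ) → ∃ σ : ℂ → ι → ℂ, HolomorphicNear E.connN σ a ∧ σ a ≠ 0 ∧
      ∀ᶠ z in 𝓝[≠] a, s z = (z - a) ^ m • σ z) ∧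
  (x = north → ∃ σ : ℂ → ι → ℂ, HolomorphicNear E.connS σ 0 ∧ σ 0 ≠ 0 ∧
      ∀ᶠ w in 𝓝[≠] (0 : ℂ), (E.trans w).mulVec (s w⁻¹) = w ^ m • σ w)

/-- `s` is a meromorphic section of `E` with divisor `D`. -/
def HasDivisor (E : HolBundle ι) (s : ℂ → ι → ℂ) (D : OnePoint ℂ →₀ ℤ) : Prop :=
  ∀ x, E.HasOrderAt s x (D x)

/-- `s` is a meromorphic section of `E`, and the degree of its divisor is `n`. -/
def HasDegree (E : HolBundle ι) (s : ℂ → ι → ℂ) (n : ℤ) : Prop :=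
  ∃ D : OnePoint ℂ →₀ ℤ, E.HasDivisor s D ∧ (D.sum fun _ m => m) = n

end HolBundle

/-! ### Line bundles, their metrics, and extensions -/

/-- The holomorphic line bundle of degree `d` on `S²`, with its canonical frames `ζ` over `S² - {N}`
and `ζ_S` over `S² - {S}`, where `ζ = w ^ d ζ_S`. -/
def lineBundle (d : ℤ) : HolBundle (Fin 1) where
  trans w := !![w ^ d]
  connN _ := 0
  connS _ := 0
  trans_holo i j := fun w hw => by
    fin_cases i; fin_cases j
    exact ((differentiableAt_zpow (m := d)).2 (Or.inl (by simpa using hw))).differentiableWithinAt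
  trans_unit w hw := by
    rw [Matrix.isUnit_iff_isUnit_det, Matrix.det_fin_one]
    exact (zpow_ne_zero d hw).isUnit
  connN_smooth _ _ := contDiff_const
  connS_smooth _ _ := contDiff_const
  compat w hw := by simp

/-- The canonical section `ζ` is meromorphic of degree `d`: this is the degree of `lineBundle d`. -/
theorem lineBundle_hasDegree (d : ℤ) : (lineBundle d).HasDegree (fun _ _ => 1) d := by
  have hol : ∀ a : ℂ, HolomorphicNear (ι := Fin 1) (fun _ => 0) (fun _ _ => 1) a := fun a =>
    Eventually.of_forall fun u => ⟨contDiffAt_const, by simp [dbar]⟩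
  have ne : ((fun _ => 1) : Fin 1 → ℂ) ≠ 0 := fun h => one_ne_zero (congrFun h 0)
  refine ⟨Finsupp.single north d, fun x => ⟨?_, ?_⟩, by simp⟩
  · rintro a rfl
    refine ⟨fun _ _ => 1, hol a, ne, Eventually.of_forall fun z => ?_⟩
    rw [Finsupp.single_eq_of_ne (by simp [north])]
    simp
  · rintro rfl
    refine ⟨fun _ _ => 1, hol 0, ne, Eventually.of_forall fun w => ?_⟩
    ext i
    simp [lineBundle, Matrix.mulVec, dotProduct]

/-- A smooth hermitian metric `H` on the line bundle of degree `d`, given by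
`normSqN = |ζ|_H²` over `S² - {N}` and `normSqS = |ζ_S|_H²` over `S² - {S}`. -/
structure HermitianMetric (d : ℤ) where
  normSqN : ℂ → ℝ
  normSqS : ℂ → ℝ
  posN : ∀ z, 0 < normSqN z
  posS : ∀ w, 0 < normSqS w
  smoothN : ContDiff ℝ ∞ normSqN
  smoothS : ContDiff ℝ ∞ normSqS
  compat : ∀ w, w ≠ 0 → normSqN w⁻¹ = ‖w‖ ^ (2 * d) * normSqS w

/-- A smooth `(0,1)`-form with values in the dual of the line bundle of degree `d`: it is
`coefN ζ^* dz̄` over `S² - {N}` and `coefS ζ_S^* dw̄` over `S² - {S}`, with `ζ^*`, `ζ_S^*` the dual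
frames. -/
structure DualForm (d : ℤ) where
  coefN : ℂ → ℂ
  coefS : ℂ → ℂ
  smoothN : ContDiff ℝ ∞ coefN
  smoothS : ContDiff ℝ ∞ coefS
  compat : ∀ w, w ≠ 0 → coefS w = -(conj w) ^ (-2 : ℤ) * w ^ (-d) * coefN w⁻¹

/-- The `H`-antiholomorphic form `η = ḡ ζ^{*H} dz̄ = ḡ |ζ|_H² ζ^* dz̄`, for a polynomial `g` in `z` of
degree at most `d - 2`. -/
def antiholForm {d : ℤ} (H : HermitianMetric d) (g : ℂ[X])
    (hg : (g.natDegree : ℤ) ≤ d - 2) : DualForm d where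
  coefN z := conj (g.eval z) * (H.normSqN z : ℂ)
  coefS w := -conj ((g.reflect (d - 2).toNat).eval w) * (H.normSqS w : ℂ)
  smoothN := by
    have h1 : ContDiff ℝ ∞ fun z : ℂ => g.eval z :=
      (g.contDiff_aeval (𝕜 := ℂ) ∞).restrict_scalars ℝ
    exact (Complex.conjCLE.contDiff.comp h1).mul (Complex.ofRealCLM.contDiff.comp H.smoothN)
  smoothS := by
    have h1 : ContDiff ℝ ∞ fun z : ℂ => (g.reflect (d - 2).toNat).eval z :=
      ((g.reflect (d - 2).toNat).contDiff_aeval (𝕜 := ℂ) ∞).restrict_scalars ℝ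
    exact (Complex.conjCLE.contDiff.comp h1).neg.mul (Complex.ofRealCLM.contDiff.comp H.smoothS)
  compat w hw := by
    obtain ⟨k, hk⟩ : ∃ k : ℕ, d = k + 2 := ⟨(d - 2).toNat, by omega⟩
    subst hk
    have hgk : g.natDegree ≤ k := by omega
    have hcw : conj w ≠ 0 := (map_ne_zero _).2 hw
    have e : ((k : ℤ) + 2 - 2).toNat = k := by omega
    have h1 : (g.reflect k).eval w = g.eval w⁻¹ * w ^ k := by
      let _ : Invertible (w⁻¹) := ⟨w, mul_inv_cancel₀ hw, inv_mul_cancel₀ hw⟩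
      have h := Polynomial.eval₂_reflect_mul_pow (RingHom.id ℂ) (w⁻¹) k g hgk
      have h' : (g.reflect k).eval w * (w⁻¹) ^ k = g.eval w⁻¹ := h
      rw [← h', mul_assoc, ← mul_pow, inv_mul_cancel₀ hw, one_pow, mul_one]
    have h2 : ((‖w‖ : ℝ) : ℂ) ^ 2 = w * conj w := (Complex.mul_conj' w).symm
    rw [H.compat w hw, e, h1]
    push_cast
    rw [zpow_mul, zpow_ofNat, h2]
    simp only [map_mul, map_pow, zpow_add₀ hw, zpow_neg, mul_zpow, zpow_add₀ hcw, zpow_natCast,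
      zpow_ofNat]
    field_simp

/-- The extension `E = L₁ ⊕ L₂` (as a smooth bundle) of the line bundle `L₂` of degree `d₂` by the
line bundle `L₁` of degree `d₁`, with `D''_η (s₁, s₂) = (D''_1 s₁ + η s₂, D''_2 s₂)`, where `η` is a
`(0,1)`-form with values in `Hom(L₂, L₁) = L^*`, `L = L₂ ⊗ L₁^*`. The frames are `(ζ₁, ζ₂)` over
`S² - {N}` and `(ζ_{1,S}, ζ_{2,S})` over `S² - {S}`. -/
def extension (d₁ d₂ : ℤ) (η : DualForm (d₂ - d₁)) : HolBundle (Fin 2) where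
  trans w := !![w ^ d₁, 0; 0, w ^ d₂]
  connN z := !![0, η.coefN z; 0, 0]
  connS w := !![0, η.coefS w; 0, 0]
  trans_holo i j := by
    have h : ∀ d : ℤ, DifferentiableOn ℂ (fun w : ℂ => w ^ d) {0}ᶜ := fun d w hw =>
      ((differentiableAt_zpow (m := d)).2 (Or.inl (by simpa using hw))).differentiableWithinAt
    fin_cases i <;> fin_cases j <;> simp [h]
  trans_unit w hw := by
    rw [Matrix.isUnit_iff_isUnit_det, Matrix.det_fin_two_of]
    simp [zpow_ne_zero _ hw]
  connN_smooth i j := by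
    fin_cases i <;> fin_cases j <;> simp [contDiff_const, η.smoothN]
  connS_smooth i j := by
    fin_cases i <;> fin_cases j <;> simp [contDiff_const, η.smoothS]
  compat w hw := by
    ext i j
    fin_cases i <;> fin_cases j <;> simp [Matrix.mul_apply, η.compat w hw]
    rw [zpow_sub₀ hw]
    field_simp

/-! ### The quantities attached to `η` and to `h` -/

/-- `|η|_H² = |g|² |ζ|_H² |dz|²` at the point with coordinate `z`, where `|dz| = 1 + |z|²`. -/
def etaNormSq {d : ℤ} (H : HermitianMetric d) (g : ℂ[X]) (z : ℂ) : ℝ :=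
  ‖g.eval z‖ ^ 2 * H.normSqN z * (1 + ‖z‖ ^ 2) ^ 2

/-- `b_j = ∫_{S²} (|η|_H² / g) w^{-j+1} ν`. -/
def bCoeff {d : ℤ} (H : HermitianMetric d) (g : ℂ[X]) (j : ℕ) : ℂ :=
  ∫ z, (etaNormSq H g z : ℂ) / g.eval z * (z⁻¹) ^ (-(j : ℤ) + 1) ∂area

/-- The meromorphic function `h = y(w) / (1 - v(w))` on `S²`, `w = 1 / z`, in the coordinate `z` of
`S² - {N}`. (Its values at its poles and at `z = 0` are immaterial.) -/
def hFun (y v : ℂ[X]) (z : ℂ) : ℂ := y.eval z⁻¹ / (1 - v.eval z⁻¹)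

/-- `s^-`: the number of poles of `h` in `S² - {N}`, counted with multiplicity. -/
def poleCount (h : ℂ → ℂ) : ℕ := ∑ᶠ a : ℂ, (-(meromorphicOrderAt h a).untop₀).toNat

/-- The `j`-th equation `b_j = y_j + (y v)_j + ⋯ + (y v^{j-1})_j`. -/
def SystemEq {d : ℤ} (H : HermitianMetric d) (g y v : ℂ[X]) (j : ℕ) : Prop :=
  bCoeff H g j = ∑ m ∈ Finset.range j, (y * v ^ m).coeff j

/-- `((f + h) ζ₁, ζ₂)`, by its coefficients in the frame `(ζ₁, ζ₂)` over `S² - {N}`. -/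
def psiTilde (f : OnePoint ℂ → ℂ) (h : ℂ → ℂ) : ℂ → Fin 2 → ℂ :=
  fun z => ![f (z : OnePoint ℂ) + h z, 1]

end SphereExt

end

open SphereExt

noncomputable section

namespace SphereExt

open scoped Topology ContDiff Polynomial ComplexConjugate
open Filter MeasureTheory

/-! ### Smooth parametric integrals and the Wirtinger derivative -/

/-! The order of the section is computed at each point, and the orders are summed.

Near a finite point `a` write `h = (z - a)^(-p) q`. Then `(f + h, 1)` is `(z - a)^(-p)` times `((z -
a)^p f + q, (z - a)^p)`. Since `∂̄f` is minus the coefficient of `η`, this vector is holomorphic for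
`D''_η`, and it does not vanish at `a`. So the order is `-p`, and the finite points contribute
`-s^-` in all.

At `N`, changing coordinate turns the equation for `f` into `∂̄f = -w^k η_S`, with `η_S` the
coefficient of `η` there. A smooth function whose `∂̄` is divisible by `w^k` is a polynomial modulo
`w^k`: `f = P + w^k U` with `∂̄U = -η_S` (`exists_polynomial_add_pow_mul`). Expanding the geometric
series, `h = ∑_{m<k} y v^m` plus `w^k` times a holomorphic function. Hence `f + h = Q + w^k (U +
holomorphic)` with `Q = P + ∑_{m<k} y v^m`. In the frame at `N` the section is `w^{d₁} (f + h,
w^k)`, so its order is `d₁ + n`, where `n` is the vanishing order of `Q` at `0`, capped at `k`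
(`hasOrderAt_psiTilde_north`).

It remains to identify `n` with `j^*`. Green's formula for `z^{j-1} f` on large discs gives `P_j =
-b_j` for `1 ≤ j < k` (`coeff_eq_neg_bCoeff`), and `P_0 = f(N) = 0`. So `Q_j = 0` is exactly the
`j`-th equation of the system. -/

theorem hasFDerivAt_intervalIntegral {E : Type} [NormedAddCommGroup E] [NormedSpace ℝ E]
    {F : ℂ → ℝ → E} (hF : ContDiff ℝ 1 (Function.uncurry F)) (a b : ℝ) (x : ℂ) :
    HasFDerivAt (fun x => ∫ t in a..b, F x t)
      (∫ t in a..b, (fderiv ℝ (Function.uncurry F) (x, t)).comp (.inl ℝ ℂ ℝ)) x := by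
  have hc : Continuous fun p : ℂ × ℝ =>
      (fderiv ℝ (Function.uncurry F) p).comp (.inl ℝ ℂ ℝ) :=
    (hF.continuous_fderiv one_ne_zero).clm_comp continuous_const
  obtain ⟨C, hC⟩ := ((isCompact_closedBall x 1).prod (isCompact_uIcc (a := a) (b := b))).exists_bound_of_continuousOn
    hc.continuousOn
  refine intervalIntegral.hasFDerivAt_integral_of_dominated_of_fderiv_le
    (F' := fun x t => (fderiv ℝ (Function.uncurry F) (x, t)).comp (.inl ℝ ℂ ℝ))
    (bound := fun _ => C) (Metric.closedBall_mem_nhds x one_pos)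
    (Eventually.of_forall fun z => ?_) ?_ ?_ ?_ intervalIntegrable_const ?_
  · exact (hF.continuous.comp (Continuous.prodMk_right z)).aestronglyMeasurable
  · exact (hF.continuous.comp (Continuous.prodMk_right x)).intervalIntegrable _ _
  · exact (hc.comp (Continuous.prodMk_right x)).aestronglyMeasurable
  · exact Eventually.of_forall fun t ht z hz => hC (z, t) ⟨hz, Set.uIoc_subset_uIcc ht⟩
  · refine Eventually.of_forall fun t _ z _ => ?_
    have h1 : HasFDerivAt (fun z : ℂ => (z, t)) (.inl ℝ ℂ ℝ) z := hasFDerivAt_prodMk_left z t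
    exact ((hF.differentiable one_ne_zero (z, t)).hasFDerivAt).comp z h1

/-- The derivative is an integral of the same kind with values in a space of linear maps; hence the
induction varies `E`. -/
theorem contDiff_nat_intervalIntegral (n : ℕ) {E : Type} [NormedAddCommGroup E] [NormedSpace ℝ E]
    {F : ℂ → ℝ → E} (hF : ContDiff ℝ ∞ (Function.uncurry F)) (a b : ℝ) :
    ContDiff ℝ n fun x => ∫ t in a..b, F x t := by
  have h1 : ContDiff ℝ 1 (Function.uncurry F) := hF.of_le (by exact_mod_cast le_top)
  induction n generalizing E with
  | zero =>
    exact contDiff_zero.2 (continuous_iff_continuousAt.2 fun x =>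
      (hasFDerivAt_intervalIntegral h1 a b x).continuousAt)
  | succ n ih =>
    have hd := hasFDerivAt_intervalIntegral h1 a b
    have h2 : ContDiff ℝ ∞ (Function.uncurry fun (x : ℂ) (t : ℝ) =>
        (fderiv ℝ (Function.uncurry F) (x, t)).comp (.inl ℝ ℂ ℝ)) :=
      (hF.fderiv_right (m := ∞) (by simp)).clm_comp contDiff_const
    rw [show ((n + 1 : ℕ) : WithTop ℕ∞) = (n : WithTop ℕ∞) + 1 by norm_cast,
      contDiff_succ_iff_fderiv]
    refine ⟨fun x => (hd x).differentiableAt, by simp, ?_⟩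
    rw [funext fun x => (hd x).fderiv]
    exact ih h2 (h2.of_le (by exact_mod_cast le_top))

theorem contDiff_intervalIntegral {E : Type} [NormedAddCommGroup E] [NormedSpace ℝ E]
    {F : ℂ → ℝ → E} (hF : ContDiff ℝ ∞ (Function.uncurry F)) (a b : ℝ) :
    ContDiff ℝ ∞ fun x => ∫ t in a..b, F x t :=
  contDiff_infty.2 fun n => contDiff_nat_intervalIntegral n hF a b

theorem dbar_add {F G : ℂ → ℂ} {u : ℂ} (hF : DifferentiableAt ℝ F u)
    (hG : DifferentiableAt ℝ G u) : dbar (fun z => F z + G z) u = dbar F u + dbar G u := by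
  simp only [dbar, fderiv_fun_add hF hG, add_apply, smul_eq_mul]
  ring

theorem dbar_eq_zero {p : ℂ → ℂ} {u : ℂ} (hp : DifferentiableAt ℂ p u) : dbar p u = 0 := by
  have h := hp.hasDerivAt.hasFDerivAt.restrictScalars ℝ
  simp only [dbar, h.fderiv, ContinuousLinearMap.coe_restrictScalars', smul_eq_mul,
    ContinuousLinearMap.toSpanSingleton_apply]
  linear_combination (1 / 2 * deriv p u) * Complex.I_mul_I

theorem dbar_mul {F G : ℂ → ℂ} {u : ℂ} (hF : DifferentiableAt ℝ F u)
    (hG : DifferentiableAt ℝ G u) :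
    dbar (fun z => F z * G z) u = F u * dbar G u + G u * dbar F u := by
  simp only [dbar, fderiv_fun_mul hF hG, add_apply, smul_eq_mul,
    smul_apply]
  ring

theorem dbar_holo_mul {p F : ℂ → ℂ} {u : ℂ} (hp : DifferentiableAt ℂ p u)
    (hF : DifferentiableAt ℝ F u) : dbar (fun z => p z * F z) u = p u * dbar F u := by
  rw [dbar_mul (hp.restrictScalars ℝ) hF, dbar_eq_zero hp, mul_zero, add_zero]

theorem dbar_congr {F G : ℂ → ℂ} {u : ℂ} (h : F =ᶠ[𝓝 u] G) : dbar F u = dbar G u := by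
  simp only [dbar, h.fderiv_eq]

/-- The Wirtinger derivative `∂F/∂u = (∂F/∂x - i ∂F/∂y) / 2`. -/
def del (F : ℂ → ℂ) (u : ℂ) : ℂ :=
  (1 / 2 : ℂ) * (fderiv ℝ F u 1 - Complex.I * fderiv ℝ F u Complex.I)

theorem fderiv_eq_del_add_dbar (F : ℂ → ℂ) (u h : ℂ) :
    fderiv ℝ F u h = del F u * h + dbar F u * conj h := by
  have e : h = h.re • (1 : ℂ) + h.im • Complex.I := by simp
  have e1 : fderiv ℝ F u h = h.re * fderiv ℝ F u 1 + h.im * fderiv ℝ F u Complex.I := by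
    conv_lhs => rw [e, map_add, map_smul, map_smul]
    simp
  have e2 : conj h = h.re - h.im * Complex.I := by
    apply Complex.ext <;> simp
  have e3 : h = h.re + h.im * Complex.I := (Complex.re_add_im h).symm
  rw [e1, e2]
  conv_rhs => rw [e3]
  simp only [del, dbar, smul_eq_mul, Complex.add_re, Complex.add_im, Complex.ofReal_re, Complex.mul_re, Complex.mul_im,
    Complex.ofReal_im, Complex.I_re, Complex.I_im]
  push_cast
  linear_combination (h.im * fderiv ℝ F u Complex.I) * Complex.I_mul_I

theorem contDiff_fderiv_apply {F : ℂ → ℂ} (hF : ContDiff ℝ ∞ F) (h : ℂ) :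
    ContDiff ℝ ∞ fun u => fderiv ℝ F u h :=
  (hF.fderiv_right (m := ∞) (by simp)).clm_apply contDiff_const

theorem contDiff_dbar {F : ℂ → ℂ} (hF : ContDiff ℝ ∞ F) : ContDiff ℝ ∞ (dbar F) := by
  have h1 := contDiff_fderiv_apply hF 1
  have h2 := contDiff_fderiv_apply hF Complex.I
  exact contDiff_const.mul (h1.add (contDiff_const.mul h2))

theorem contDiff_del {F : ℂ → ℂ} (hF : ContDiff ℝ ∞ F) : ContDiff ℝ ∞ (del F) := by
  have h1 := contDiff_fderiv_apply hF 1
  have h2 := contDiff_fderiv_apply hF Complex.I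
  exact contDiff_const.mul (h1.sub (contDiff_const.mul h2))

theorem contDiff_conj : ContDiff ℝ ∞ fun z : ℂ => conj z := Complex.conjCLE.contDiff

theorem contDiff_ofReal : ContDiff ℝ ∞ fun t : ℝ => (t : ℂ) := Complex.ofRealCLM.contDiff

/-! ### Division by powers of the coordinate -/

/-- Integrating `d/dt φ(tz)` over `[0, 1]` gives `z ∂φ(tz) + z̄ ∂̄φ(tz)` under the integral. Since
`∂̄φ(tz) = t z G(tz)`, the factor `z` comes out of both terms, and what remains is a smooth
parametric integral. -/
theorem exists_smooth_div {φ G : ℂ → ℂ} (hφ : ContDiff ℝ ∞ φ) (hG : ContDiff ℝ ∞ G)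
    (h0 : φ 0 = 0) (h : ∀ z, dbar φ z = z * G z) :
    ∃ ψ : ℂ → ℂ, ContDiff ℝ ∞ ψ ∧ (∀ z, φ z = z * ψ z) ∧ ∀ z, dbar ψ z = G z := by
  have hK : ContDiff ℝ ∞ (Function.uncurry fun (z : ℂ) (t : ℝ) =>
      del φ (t * z) + conj z * (t * G (t * z))) := by
    have ht : ContDiff ℝ ∞ fun p : ℂ × ℝ => (p.2 : ℂ) := contDiff_ofReal.comp contDiff_snd
    have hm : ContDiff ℝ ∞ fun p : ℂ × ℝ => (p.2 : ℂ) * p.1 := ht.mul contDiff_fst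
    exact ((contDiff_del hφ).comp hm).add
      ((contDiff_conj.comp contDiff_fst).mul (ht.mul (hG.comp hm)))
  have hψ := contDiff_intervalIntegral hK 0 1
  have hmul : ∀ z, φ z = z * ∫ t in (0 : ℝ)..1, (del φ (t * z) + conj z * (t * G (t * z))) := by
    intro z
    have hd : ∀ t : ℝ, HasDerivAt (fun t : ℝ => φ (t * z))
        (z * (del φ (t * z) + conj z * (t * G (t * z)))) t := by
      intro t
      have h1 : HasDerivAt (fun t : ℝ => (t : ℂ) * z) z t := by
        simpa using (Complex.ofRealCLM.hasDerivAt (x := t)).mul_const z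
      have h2 := ((hφ.differentiable (by simp) (t * z)).hasFDerivAt).comp_hasDerivAt t h1
      rw [fderiv_eq_del_add_dbar, h] at h2
      exact h2.congr_deriv (by ring)
    have hint := intervalIntegral.integral_eq_sub_of_hasDerivAt (a := 0) (b := 1)
      (fun t _ => hd t)
      ((continuous_const.mul (hK.continuous.comp (Continuous.prodMk_right z))).intervalIntegrable _ _)
    rw [intervalIntegral.integral_const_mul] at hint
    simp [h0] at hint
    exact hint.symm
  refine ⟨_, hψ, hmul, ?_⟩
  -- Cancelling `z` gives the equation off `0` only; continuity of both sides gives it at `0`.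
  refine congrFun (Continuous.ext_on (dense_compl_singleton (0 : ℂ)) (contDiff_dbar hψ).continuous
    hG.continuous fun z hz => ?_)
  refine mul_left_cancel₀ (show z ≠ 0 from hz) ?_
  rw [← h z, ← dbar_holo_mul (p := fun z => z) differentiableAt_id
    (hψ.differentiable (by simp) z)]
  exact (dbar_congr (Eventually.of_forall hmul)).symm

/-- A smooth function with `∂̄φ = z ^ k G` is a polynomial modulo `z ^ k`. -/
theorem exists_polynomial_add_pow_mul (k : ℕ) {φ G : ℂ → ℂ} (hφ : ContDiff ℝ ∞ φ)
    (hG : ContDiff ℝ ∞ G) (h : ∀ z, dbar φ z = z ^ k * G z) :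
    ∃ (P : ℂ[X]) (U : ℂ → ℂ), ContDiff ℝ ∞ U ∧ (∀ z, φ z = P.eval z + z ^ k * U z) ∧
      ∀ z, dbar U z = G z := by
  induction k generalizing φ with
  | zero => exact ⟨0, φ, hφ, by simp, by simpa using h⟩
  | succ k ih =>
    have hG' : ContDiff ℝ ∞ fun z => z ^ k * G z := (contDiff_id.pow k).mul hG
    obtain ⟨ψ, hψ, h1, h2⟩ := exists_smooth_div (φ := fun z => φ z + -φ 0)
      (hφ.add contDiff_const) hG' (by simp) (fun z => by
        rw [dbar_add (hφ.differentiable (by simp) z) (differentiableAt_const _),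
          dbar_eq_zero (differentiableAt_const _), h]
        ring)
    obtain ⟨P, U, hU, h3, h4⟩ := ih hψ h2
    refine ⟨Polynomial.C (φ 0) + Polynomial.X * P, U, hU, fun z => ?_, h4⟩
    have := h1 z
    rw [h3] at this
    simp only [Polynomial.eval_add, Polynomial.eval_mul, Polynomial.eval_C, Polynomial.eval_X]
    linear_combination this

/-! ### Green's formula on discs -/

theorem contDiff_polar : ContDiff ℝ ∞ fun p : ℝ × ℝ => (p.1 : ℂ) * Complex.exp (p.2 * Complex.I) :=
  (contDiff_ofReal.comp contDiff_fst).mul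
    (((contDiff_ofReal.comp contDiff_snd).mul contDiff_const).cexp)

theorem fderiv_apply_eq_of_hasDerivAt {A : ℝ × ℝ → ℂ} {x : ℝ × ℝ} (hA : DifferentiableAt ℝ A x)
    {l : ℝ → ℝ × ℝ} {l' : ℝ × ℝ} {t : ℝ} {c : ℂ} (hl : HasDerivAt l l' t) (hx : l t = x)
    (h : HasDerivAt (fun s => A (l s)) c t) : fderiv ℝ A x l' = c := by
  subst hx
  exact (hA.hasFDerivAt.comp_hasDerivAt t hl).unique h

theorem exp_mul_conj_exp (t : ℝ) :
    Complex.exp (t * Complex.I) * conj (Complex.exp (t * Complex.I)) = 1 := by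
  rw [← Complex.exp_conj, ← Complex.exp_add]
  simp

/-- With `u = r e^{it}`, put `A = G(u) u` and `B = i e^{it} G(u)`. The terms in `G` and `∂G` cancel
in `∂_r A + ∂_t B`, leaving `2 r ∂̄G(u)`. In the divergence theorem on `[0, R] × [-π, π]`, the side
`r = 0` contributes nothing and the sides `t = ±π` cancel by periodicity. -/
theorem integral_polar_dbar {G : ℂ → ℂ} (hG : ContDiff ℝ ∞ G) (R : ℝ) :
    ∫ r in (0 : ℝ)..R, ∫ t in (-Real.pi)..Real.pi,
        2 * (r * dbar G (r * Complex.exp (t * Complex.I))) =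
      ∫ t in (-Real.pi)..Real.pi,
        G (R * Complex.exp (t * Complex.I)) * (R * Complex.exp (t * Complex.I)) := by
  set A : ℝ × ℝ → ℂ := fun p =>
    G (p.1 * Complex.exp (p.2 * Complex.I)) * (p.1 * Complex.exp (p.2 * Complex.I)) with hAdef
  set B : ℝ × ℝ → ℂ := fun p =>
    Complex.I * Complex.exp (p.2 * Complex.I) * G (p.1 * Complex.exp (p.2 * Complex.I)) with hBdef
  have hA : ContDiff ℝ ∞ A := (hG.comp contDiff_polar).mul contDiff_polar
  have hB : ContDiff ℝ ∞ B :=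
    (contDiff_const.mul (((contDiff_ofReal.comp contDiff_snd).mul contDiff_const).cexp)).mul
      (hG.comp contDiff_polar)
  have hAd := hA.differentiable (by simp)
  have hBd := hB.differentiable (by simp)
  have hGd := hG.differentiable (by simp)
  have key : ∀ p : ℝ × ℝ, fderiv ℝ A p (1, 0) + fderiv ℝ B p (0, 1) =
      2 * (p.1 * dbar G (p.1 * Complex.exp (p.2 * Complex.I))) := by
    rintro ⟨r, t⟩
    set e := Complex.exp (t * Complex.I) with he
    have hr : HasDerivAt (fun s : ℝ => (s : ℂ) * e) e r := by
      simpa using (Complex.ofRealCLM.hasDerivAt (x := r)).mul_const e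
    have ht : HasDerivAt (fun s : ℝ => Complex.exp (s * Complex.I)) (Complex.I * e) t := by
      have h0 : HasDerivAt (fun s : ℝ => (s : ℂ) * Complex.I) Complex.I t := by
        simpa using (Complex.ofRealCLM.hasDerivAt (x := t)).mul_const Complex.I
      exact h0.cexp.congr_deriv (mul_comm _ _)
    have e1 := fderiv_apply_eq_of_hasDerivAt (hAd (r, t))
      ((hasDerivAt_id r).prodMk (hasDerivAt_const r t)) rfl
      (((hGd (r * e)).hasFDerivAt.comp_hasDerivAt r hr).mul hr)
    have e2 := fderiv_apply_eq_of_hasDerivAt (hBd (r, t))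
      ((hasDerivAt_const t r).prodMk (hasDerivAt_id t)) rfl
      ((ht.const_mul Complex.I).mul
        ((hGd (r * e)).hasFDerivAt.comp_hasDerivAt t (ht.const_mul (r : ℂ))))
    rw [e1, e2]
    simp only [fderiv_eq_del_add_dbar, map_mul, Complex.conj_ofReal, Complex.conj_I,
      id, ← he]
    have hee : e * conj e = 1 := exp_mul_conj_exp t
    linear_combination (2 * r * dbar G (r * e)) * hee +
      (e * G (r * e) + r * e * e * del G (r * e) - r * e * conj e * dbar G (r * e)) *
        Complex.I_mul_I
  have hcont : Continuous fun p => fderiv ℝ A p (1, 0) + fderiv ℝ B p (0, 1) :=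
    ((hA.continuous_fderiv (by simp)).clm_apply continuous_const).add
      ((hB.continuous_fderiv (by simp)).clm_apply continuous_const)
  have hdiv := integral2_divergence_prod_of_hasFDerivAt A B (fderiv ℝ A) (fderiv ℝ B)
    0 (-Real.pi) R Real.pi hA.continuous.continuousOn hB.continuous.continuousOn
    (fun x _ => (hAd x).hasFDerivAt) (fun x _ => (hBd x).hasFDerivAt)
    (hcont.continuousOn.integrableOn_compact (isCompact_uIcc.prod isCompact_uIcc))
  simp only [key] at hdiv
  rw [hdiv]
  simp [hAdef, hBdef, Complex.exp_neg]

theorem setIntegral_ball_eq_polar {ψ : ℂ → ℂ} (hψ : Continuous ψ) {R : ℝ} (hR : 0 ≤ R) :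
    ∫ z in Metric.ball (0 : ℂ) R, ψ z = ∫ r in (0 : ℝ)..R, ∫ t in (-Real.pi)..Real.pi,
        r * ψ (r * Complex.exp (t * Complex.I)) := by
  have hs : ∀ p : ℝ × ℝ, Complex.polarCoord.symm p = p.1 * Complex.exp (p.2 * Complex.I) := by
    intro p
    rw [Complex.polarCoord_symm_apply, Complex.exp_mul_I]
    simp
  have hc : Continuous fun p : ℝ × ℝ => (p.1 : ℂ) * ψ (p.1 * Complex.exp (p.2 * Complex.I)) := by
    fun_prop
  have hsub : Set.Ioo 0 R ×ˢ Set.Ioo (-Real.pi) Real.pi ⊆ polarCoord.target := by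
    rw [polarCoord_target]
    exact Set.prod_mono Set.Ioo_subset_Ioi_self subset_rfl
  rw [← integral_indicator Metric.isOpen_ball.measurableSet, ← Complex.integral_comp_polarCoord_symm]
  have h1 : ∫ p in polarCoord.target,
        p.1 • (Metric.ball (0 : ℂ) R).indicator ψ (Complex.polarCoord.symm p) =
      ∫ p in Set.Ioo 0 R ×ˢ Set.Ioo (-Real.pi) Real.pi,
        (p.1 : ℂ) * ψ (p.1 * Complex.exp (p.2 * Complex.I)) := by
    rw [← integral_indicator (measurableSet_Ioo.prod measurableSet_Ioo),
      ← integral_indicator polarCoord.open_target.measurableSet]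
    congr 1
    funext p
    by_cases hp : p ∈ polarCoord.target
    · have hp' := hp
      rw [polarCoord_target] at hp'
      obtain ⟨h1 : 0 < p.1, h2⟩ := hp'
      have hn : ‖(p.1 : ℂ) * Complex.exp (p.2 * Complex.I)‖ = p.1 := by
        rw [norm_mul, Complex.norm_exp_ofReal_mul_I, mul_one, Complex.norm_real, Real.norm_eq_abs,
          abs_of_pos h1]
      rw [Set.indicator_of_mem hp, hs]
      by_cases hpR : p.1 < R
      · rw [Set.indicator_of_mem (mem_ball_zero_iff.2 (hn.trans_lt hpR)),
          Set.indicator_of_mem (s := Set.Ioo 0 R ×ˢ Set.Ioo (-Real.pi) Real.pi) ⟨⟨h1, hpR⟩, h2⟩, Complex.real_smul]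
      · rw [Set.indicator_of_notMem (fun h => hpR (hn ▸ mem_ball_zero_iff.1 h)),
          Set.indicator_of_notMem (fun h => hpR h.1.2), smul_zero]
    · rw [Set.indicator_of_notMem hp, Set.indicator_of_notMem fun h => hp (hsub h)]
  rw [h1, Measure.volume_eq_prod, setIntegral_prod, intervalIntegral.integral_of_le hR,
    integral_Ioc_eq_integral_Ioo]
  · simp only [intervalIntegral.integral_of_le (neg_le_self Real.pi_pos.le),
      integral_Ioc_eq_integral_Ioo]
  · exact (hc.continuousOn.integrableOn_compact (isCompact_Icc.prod isCompact_Icc)).mono_set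
      (Set.prod_mono Set.Ioo_subset_Icc_self Set.Ioo_subset_Icc_self)

/-- Green's formula on a disc. -/
theorem setIntegral_ball_dbar {G : ℂ → ℂ} (hG : ContDiff ℝ ∞ G) {R : ℝ} (hR : 0 ≤ R) :
    2 * ∫ z in Metric.ball (0 : ℂ) R, dbar G z =
      ∫ t in (-Real.pi)..Real.pi,
        G (R * Complex.exp (t * Complex.I)) * (R * Complex.exp (t * Complex.I)) := by
  rw [← integral_polar_dbar hG, setIntegral_ball_eq_polar (contDiff_dbar hG).continuous hR]
  simp only [intervalIntegral.integral_const_mul]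

/-! ### The Taylor coefficients of `f` at the north pole -/

theorem integral_polar_zpow (R : ℝ) (n : ℤ) :
    ∫ t in (-Real.pi)..Real.pi, ((R : ℂ) * Complex.exp (t * Complex.I)) ^ n =
      if n = 0 then 2 * (Real.pi : ℂ) else 0 := by
  split_ifs with hn
  · subst hn
    simp only [zpow_zero, intervalIntegral.integral_const, sub_neg_eq_add, Complex.real_smul]
    push_cast
    ring
  · have hc : (n : ℂ) * Complex.I ≠ 0 := mul_ne_zero (by exact_mod_cast hn) Complex.I_ne_zero
    have e : ∀ t : ℝ, ((R : ℂ) * Complex.exp (t * Complex.I)) ^ n =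
        R ^ n * Complex.exp (n * Complex.I * t) := by
      intro t
      rw [mul_zpow, ← Complex.exp_int_mul]
      congr 2
      ring
    simp only [e, intervalIntegral.integral_const_mul, integral_exp_mul_complex hc]
    have e2 : Complex.exp (n * Complex.I * Real.pi) =
        Complex.exp (n * Complex.I * ((-Real.pi : ℝ) : ℂ)) := by
      rw [Complex.exp_eq_exp_iff_exists_int]
      exact ⟨n, by push_cast; ring⟩
    rw [e2, sub_self, zero_div, mul_zero]

theorem integral_polar_polynomial {R : ℝ} (hR : 0 < R) (P : ℂ[X]) (j : ℕ) :
    ∫ t in (-Real.pi)..Real.pi, P.eval ((R : ℂ) * Complex.exp (t * Complex.I))⁻¹ *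
      ((R : ℂ) * Complex.exp (t * Complex.I)) ^ j = 2 * Real.pi * P.coeff j := by
  have hne : ∀ t : ℝ, (R : ℂ) * Complex.exp (t * Complex.I) ≠ 0 := fun t =>
    mul_ne_zero (by exact_mod_cast hR.ne') (Complex.exp_ne_zero _)
  have e : ∀ t : ℝ, P.eval ((R : ℂ) * Complex.exp (t * Complex.I))⁻¹ *
      ((R : ℂ) * Complex.exp (t * Complex.I)) ^ j =
      ∑ i ∈ Finset.range (P.natDegree + 1),
        P.coeff i * ((R : ℂ) * Complex.exp (t * Complex.I)) ^ ((j : ℤ) - i) := by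
    intro t
    rw [Polynomial.eval_eq_sum_range, Finset.sum_mul]
    refine Finset.sum_congr rfl fun i _ => ?_
    rw [zpow_sub₀ (hne t), zpow_natCast, zpow_natCast, inv_pow]
    ring
  simp only [e]
  rw [intervalIntegral.integral_finsetSum]
  · simp only [intervalIntegral.integral_const_mul, integral_polar_zpow R, sub_eq_zero,
      Nat.cast_inj, mul_ite, mul_zero, Finset.sum_ite_eq, Finset.mem_range]
    split_ifs with h
    · ring
    · rw [Polynomial.coeff_eq_zero_of_natDegree_lt (by omega), mul_zero]
  · intro i _
    refine (continuous_const.mul (Continuous.zpow₀ (by fun_prop) _ fun t => ?_)).intervalIntegrable _ _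
    exact Or.inl (hne t)

/-- The moments of `∂̄F` are the coefficients of the expansion of `F` at infinity. -/
theorem integral_pow_mul_dbar {k j : ℕ} (hj : 1 ≤ j) (hjk : j < k) {F U : ℂ → ℂ} {P : ℂ[X]}
    (hF : ContDiff ℝ ∞ F) (hU : Continuous U)
    (h : ∀ z, z ≠ 0 → F z = P.eval z⁻¹ + z⁻¹ ^ k * U z⁻¹)
    (hint : Integrable fun z => z ^ (j - 1) * dbar F z) :
    ∫ z, z ^ (j - 1) * dbar F z = Real.pi * P.coeff j := by
  have hpow : ContDiff ℝ ∞ fun z : ℂ => z ^ (j - 1) := contDiff_id.pow _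
  have hG : ContDiff ℝ ∞ fun z : ℂ => z ^ (j - 1) * F z := hpow.mul hF
  have hdG : ∀ z, dbar (fun z : ℂ => z ^ (j - 1) * F z) z = z ^ (j - 1) * dbar F z := fun z =>
    dbar_holo_mul (p := fun z : ℂ => z ^ (j - 1)) (by fun_prop) (hF.differentiable (by simp) z)
  obtain ⟨C, hC⟩ := (isCompact_closedBall (0 : ℂ) 1).exists_bound_of_continuousOn hU.continuousOn
  -- Green's formula turns the integral over the disc into that of `u^j F(u)` over `|u| = R`. The
  -- part `P` contributes `2π P_j`, and the remainder `u^{j-k} U(1/u)` is at most `C / R` because `j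
  -- < k`.
  have hgreen : ∀ R : ℝ, 1 ≤ R →
      ‖2 * (∫ z in Metric.ball (0 : ℂ) R, z ^ (j - 1) * dbar F z) - 2 * Real.pi * P.coeff j‖ ≤
        C * R⁻¹ * |Real.pi - -Real.pi| := by
    intro R hR
    have hR0 : 0 < R := by linarith
    have hne : ∀ t : ℝ, (R : ℂ) * Complex.exp (t * Complex.I) ≠ 0 := fun t =>
      mul_ne_zero (by exact_mod_cast hR0.ne') (Complex.exp_ne_zero _)
    have hnorm : ∀ t : ℝ, ‖(R : ℂ) * Complex.exp (t * Complex.I)‖ = R := fun t => by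
      rw [norm_mul, Complex.norm_exp_ofReal_mul_I, mul_one, Complex.norm_real, Real.norm_eq_abs,
        abs_of_pos hR0]
    have h1 := setIntegral_ball_dbar hG hR0.le
    simp only [hdG] at h1
    have hc1 : Continuous fun t : ℝ => ((R : ℂ) * Complex.exp (t * Complex.I)) ^ (j - 1) *
        F (R * Complex.exp (t * Complex.I)) * (R * Complex.exp (t * Complex.I)) := by
      have := hF.continuous
      fun_prop
    have hc2 : Continuous fun t : ℝ => P.eval ((R : ℂ) * Complex.exp (t * Complex.I))⁻¹ *
        ((R : ℂ) * Complex.exp (t * Complex.I)) ^ j := by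
      refine (P.continuous.comp (Continuous.inv₀ (by fun_prop) hne)).mul (by fun_prop)
    rw [h1, ← integral_polar_polynomial hR0 P j,
      ← intervalIntegral.integral_sub (hc1.intervalIntegrable _ _) (hc2.intervalIntegrable _ _)]
    refine intervalIntegral.norm_integral_le_of_norm_le_const fun t _ => ?_
    set u := (R : ℂ) * Complex.exp (t * Complex.I) with hu
    have e : u ^ (j - 1) * F u * u - P.eval u⁻¹ * u ^ j = u⁻¹ ^ (k - j) * U u⁻¹ := by
      obtain ⟨m, rfl⟩ : ∃ m, k = j + m := ⟨k - j, by omega⟩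
      obtain ⟨i, rfl⟩ : ∃ i, j = i + 1 := ⟨j - 1, by omega⟩
      rw [h u (hne t), Nat.add_sub_cancel_left, Nat.add_sub_cancel, pow_add u⁻¹]
      have : u ^ (i + 1) * u⁻¹ ^ (i + 1) = 1 := by
        rw [← mul_pow, mul_inv_cancel₀ (hne t), one_pow]
      linear_combination (u⁻¹ ^ m * U u⁻¹) * this
    have hu1 : ‖u⁻¹‖ ≤ 1 := by
      rw [norm_inv, hnorm t]
      exact inv_le_one_of_one_le₀ hR
    have hUC := hC u⁻¹ (mem_closedBall_zero_iff.2 hu1)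
    rw [e, norm_mul, norm_pow, mul_comm]
    refine mul_le_mul hUC ?_ (by positivity) ((norm_nonneg _).trans hUC)
    calc ‖u⁻¹‖ ^ (k - j) ≤ ‖u⁻¹‖ ^ 1 :=
          pow_le_pow_of_le_one (norm_nonneg _) hu1 (by omega)
      _ = R⁻¹ := by rw [pow_one, norm_inv, hnorm t]
  have hlim1 : Tendsto (fun R : ℝ => 2 * ∫ z in Metric.ball (0 : ℂ) R, z ^ (j - 1) * dbar F z)
      atTop (𝓝 (2 * ∫ z, z ^ (j - 1) * dbar F z)) := by
    refine Tendsto.const_mul _ ?_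
    have hU : ⋃ R : ℝ, Metric.ball (0 : ℂ) R = Set.univ := by
      refine Set.eq_univ_of_forall fun z => Set.mem_iUnion.2 ⟨‖z‖ + 1, ?_⟩
      simp
    have := tendsto_setIntegral_of_monotone (fun R : ℝ => measurableSet_ball)
      (fun _ _ h => Metric.ball_subset_ball h) (hint.integrableOn (s := ⋃ R : ℝ, Metric.ball 0 R))
    rwa [hU, setIntegral_univ] at this
  have hlim2 : Tendsto (fun R : ℝ => 2 * ∫ z in Metric.ball (0 : ℂ) R, z ^ (j - 1) * dbar F z)
      atTop (𝓝 (2 * Real.pi * P.coeff j)) := by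
    rw [tendsto_iff_norm_sub_tendsto_zero]
    refine squeeze_zero' (Eventually.of_forall fun _ => norm_nonneg _)
      ((eventually_ge_atTop 1).mono hgreen) ?_
    simpa using (tendsto_inv_atTop_zero.const_mul C).mul_const |Real.pi - -Real.pi|
  have := tendsto_nhds_unique hlim1 hlim2
  linear_combination this / 2

theorem dbar_comp_holo {p F : ℂ → ℂ} {u : ℂ} (hp : DifferentiableAt ℂ p u)
    (hF : DifferentiableAt ℝ F (p u)) :
    dbar (fun z => F (p z)) u = conj (deriv p u) * dbar F (p u) := by
  have h1 : HasFDerivAt (fun z => F (p z)) _ u :=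
    hF.hasFDerivAt.comp u (hp.hasDerivAt.hasFDerivAt.restrictScalars ℝ)
  rw [dbar, h1.fderiv]
  simp only [ContinuousLinearMap.comp_apply, ContinuousLinearMap.coe_restrictScalars',
    ContinuousLinearMap.toSpanSingleton_apply, fderiv_eq_del_add_dbar, smul_eq_mul, map_mul,
    Complex.conj_I, one_mul]
  linear_combination (1 / 2 * (del F (p u) * deriv p u - dbar F (p u) * conj (deriv p u))) *
    Complex.I_mul_I

theorem ofW_of_ne {w : ℂ} (hw : w ≠ 0) : ofW w = ((w⁻¹ : ℂ) : OnePoint ℂ) := if_neg hw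

/-- The conjugate derivative of `1/w` cancels the factor `-w̄^{-2}` in the transition rule of `η`,
so only `w^k` is left. The computation is off `w = 0` and extends by continuity. -/
theorem dbar_comp_ofW {d : ℤ} {k : ℕ} (hd : d = k) (η : DualForm d) {f : OnePoint ℂ → ℂ} (hf : SmoothOnSphere f)
    (hfeq : ∀ z : ℂ, dbar (fun u : ℂ => f (u : OnePoint ℂ)) z = -η.coefN z) (w : ℂ) :
    dbar (fun w => f (ofW w)) w = w ^ k * -η.coefS w := by
  subst hd
  refine congrFun (Continuous.ext_on (dense_compl_singleton (0 : ℂ)) (contDiff_dbar hf.2).continuous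
    (g := fun w => w ^ k * -η.coefS w)
    ((continuous_pow k).mul η.smoothS.continuous.neg) fun w hw => ?_) w
  have hw : w ≠ 0 := hw
  have h1 : (fun w => f (ofW w)) =ᶠ[𝓝 w] fun w => f ((w⁻¹ : ℂ) : OnePoint ℂ) := by
    filter_upwards [eventually_ne_nhds hw] with u hu
    rw [ofW_of_ne hu]
  show dbar (fun w => f (ofW w)) w = w ^ k * -η.coefS w
  rw [dbar_congr h1, dbar_comp_holo (p := fun w => w⁻¹) (F := fun u : ℂ => f u)
    (differentiableAt_inv hw) (hf.1.differentiable (by simp) _), hfeq, η.compat w hw]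
  have hcw : conj w ≠ 0 := (map_ne_zero _).2 hw
  simp [zpow_neg]
  field_simp

theorem integrable_pow_mul_coefN {k j : ℕ} (hj : 1 ≤ j) (hjk : j < k) (η : DualForm k) :
    Integrable fun z => z ^ (j - 1) * η.coefN z := by
  have hc : Continuous fun z => z ^ (j - 1) * η.coefN z :=
    (continuous_pow _).mul η.smoothN.continuous
  obtain ⟨C, hC⟩ := (isCompact_closedBall (0 : ℂ) 1).exists_bound_of_continuousOn
    η.smoothS.continuous.continuousOn
  have hr : (Module.finrank ℝ ℂ : ℝ) < 4 := by
    rw [Complex.finrank_real_complex]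
    norm_num
  refine hc.locallyIntegrable.integrable_of_isBigO_cocompact
    (g := fun z : ℂ => (1 + ‖z‖) ^ (-4 : ℝ)) ?_ ((integrable_one_add_norm hr).integrableAtFilter _)
  -- For `|z| ≥ 1` the integrand has modulus `|z|^{-2} |z|^{-(k-j+1)} |η_S(1/z)|`, which is at most
  -- `C |z|^{-4}` since `j < k`. The factor `16` comes from `1 + |z| ≤ 2|z|`.
  refine Asymptotics.IsBigO.of_bound (C * 16) ?_
  filter_upwards [tendsto_norm_cocompact_atTop.eventually_ge_atTop 1] with z hz
  have hz0 : z ≠ 0 := norm_pos_iff.1 (by linarith)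
  have hcz : conj z ≠ 0 := (map_ne_zero _).2 hz0
  have hinv : ‖z⁻¹‖ ≤ 1 := by
    rw [norm_inv]
    exact inv_le_one_of_one_le₀ hz
  have hSC := hC z⁻¹ (mem_closedBall_zero_iff.2 hinv)
  have hC0 : 0 ≤ C := (norm_nonneg _).trans hSC
  have e : z ^ (j - 1) * η.coefN z = -(conj z)⁻¹ ^ 2 * z⁻¹ ^ (k - j + 1) * η.coefS z⁻¹ := by
    obtain ⟨m, rfl⟩ : ∃ m, k = j + m := ⟨k - j, by omega⟩
    obtain ⟨i, rfl⟩ : ∃ i, j = i + 1 := ⟨j - 1, by omega⟩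
    rw [η.compat z⁻¹ (inv_ne_zero hz0), Nat.add_sub_cancel_left, Nat.add_sub_cancel]
    have e1 : (z⁻¹) ^ (-(((i + 1 + m : ℕ) : ℤ))) = z ^ (i + 1 + m) := by
      rw [zpow_neg, zpow_natCast, inv_pow, inv_inv]
    have e2 : (conj z⁻¹) ^ (-2 : ℤ) = conj z ^ 2 := by
      rw [zpow_neg, map_inv₀, inv_zpow, inv_inv, zpow_ofNat]
    have e3 : z⁻¹ ^ (m + 1) * z ^ (i + 1 + m) = z ^ i := by
      rw [show i + 1 + m = m + 1 + i by ring, pow_add z, ← mul_assoc, ← mul_pow,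
        inv_mul_cancel₀ hz0, one_pow, one_mul]
    have e4 : (conj z)⁻¹ ^ 2 * conj z ^ 2 = 1 := by
      rw [← mul_pow, inv_mul_cancel₀ hcz, one_pow]
    rw [e1, e2, inv_inv]
    linear_combination (-η.coefN z) * e3 -
      (z⁻¹ ^ (m + 1) * z ^ (i + 1 + m) * η.coefN z) * e4
  have hk : ‖z‖⁻¹ ^ (k - j + 1) ≤ ‖z‖⁻¹ ^ 2 :=
    pow_le_pow_of_le_one (by positivity) (norm_inv z ▸ hinv) (by omega)
  have h16 : (1 + ‖z‖) ^ 4 ≤ (2 * ‖z‖) ^ 4 := pow_le_pow_left₀ (by positivity) (by linarith) 4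
  rw [e, norm_mul, norm_mul, norm_neg, norm_pow, norm_pow, norm_inv, norm_inv, RCLike.norm_conj,
    Real.norm_of_nonneg (by positivity), Real.rpow_neg (by positivity),
    show (4 : ℝ) = ((4 : ℕ) : ℝ) by norm_num, Real.rpow_natCast]
  calc ‖z‖⁻¹ ^ 2 * ‖z‖⁻¹ ^ (k - j + 1) * ‖η.coefS z⁻¹‖ ≤ ‖z‖⁻¹ ^ 2 * ‖z‖⁻¹ ^ 2 * C := by gcongr
    _ = C * 16 * ((2 * ‖z‖) ^ 4)⁻¹ := by field_simp; norm_num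
    _ ≤ C * 16 * ((1 + ‖z‖) ^ 4)⁻¹ := by gcongr

theorem bCoeff_eq {d : ℤ} (H : HermitianMetric d) (g : ℂ[X]) (hg : (g.natDegree : ℤ) ≤ d - 2)
    {j : ℕ} (hj : 1 ≤ j) :
    bCoeff H g j = (Real.pi : ℂ)⁻¹ * ∫ z, z ^ (j - 1) * (antiholForm H g hg).coefN z := by
  have hm : Measurable fun z : ℂ => ENNReal.ofReal (1 / (Real.pi * (1 + ‖z‖ ^ 2) ^ 2)) := by
    fun_prop
  rw [bCoeff, area, integral_withDensity_eq_integral_toReal_smul hm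
    (Eventually.of_forall fun _ => ENNReal.ofReal_lt_top), ← integral_const_mul]
  congr 1
  funext z
  have hpi : (Real.pi : ℂ) ≠ 0 := by exact_mod_cast Real.pi_ne_zero
  have hz : (1 + (‖z‖ : ℂ) ^ 2) ≠ 0 := by
    exact_mod_cast (by positivity : (1 + ‖z‖ ^ 2 : ℝ) ≠ 0)
  have e1 : (z⁻¹) ^ (-(j : ℤ) + 1) = z ^ (j - 1) := by
    rw [show -(j : ℤ) + 1 = -((j - 1 : ℕ) : ℤ) by omega, zpow_neg, zpow_natCast, inv_pow, inv_inv]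
  rw [ENNReal.toReal_ofReal (by positivity), e1, Complex.real_smul]
  simp only [etaNormSq, antiholForm]
  -- At a zero of `g` the convention `x / 0 = 0` agrees with the intended reading, since `ḡ |ζ|²`
  -- vanishes there too.
  by_cases h0 : g.eval z = 0
  · simp [h0]
  · push_cast
    rw [← Complex.mul_conj' (g.eval z)]
    field_simp

/-- The numbers `-b_j` are the coefficients of the expansion of `f` at the north pole. -/
theorem coeff_eq_neg_bCoeff {d : ℤ} {k : ℕ} (hd : d = k) (H : HermitianMetric d) (g : ℂ[X])
    (hg : (g.natDegree : ℤ) ≤ d - 2) {f : OnePoint ℂ → ℂ} (hf : SmoothOnSphere f)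
    (hfeq : ∀ z : ℂ, dbar (fun u : ℂ => f (u : OnePoint ℂ)) z = -(antiholForm H g hg).coefN z)
    {P : ℂ[X]} {U : ℂ → ℂ} (hU : Continuous U)
    (hPU : ∀ w, f (ofW w) = P.eval w + w ^ k * U w) {j : ℕ} (hj : 1 ≤ j) (hjk : j < k) :
    P.coeff j = -bCoeff H g j := by
  subst hd
  have h := integral_pow_mul_dbar hj hjk hf.1 (P := P) hU (fun z hz => by
      rw [← hPU, ofW_of_ne (inv_ne_zero hz), inv_inv])
    (by simpa [hfeq] using (integrable_pow_mul_coefN hj hjk (antiholForm H g hg)).neg)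
  simp only [hfeq, mul_neg, integral_neg] at h
  have hpi : (Real.pi : ℂ) ≠ 0 := by exact_mod_cast Real.pi_ne_zero
  rw [bCoeff_eq H g hg hj, ← mul_neg, h, inv_mul_cancel_left₀ hpi]

/-! ### Local orders of `((f + h) ζ₁, ζ₂)` -/

theorem dbar_pi {σ : ℂ → Fin 2 → ℂ} {u : ℂ} (hσ : DifferentiableAt ℝ σ u) (i : Fin 2) :
    dbar σ u i = dbar (fun z => σ z i) u := by
  have h : ∀ x, fderiv ℝ (fun z => σ z i) u x = fderiv ℝ σ u x i := fun x => by
    rw [((hasFDerivAt_pi'.1 hσ.hasFDerivAt) i).fderiv]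
    rfl
  simp [dbar, h]

theorem holomorphicNear_extension {c A B : ℂ → ℂ} {a : ℂ}
    (hA : ∀ᶠ u in 𝓝 a, ContDiffAt ℝ ∞ A u ∧ dbar A u + c u * B u = 0)
    (hB : AnalyticAt ℂ B a) :
    HolomorphicNear (fun z => !![0, c z; 0, 0]) (fun z => ![A z, B z]) a := by
  filter_upwards [hA, hB.eventually_analyticAt] with u hu hBu
  have hBu' : ContDiffAt ℝ ∞ B u := (hBu.contDiffAt (n := ∞)).restrict_scalars ℝ
  have hσ : ContDiffAt ℝ ∞ (fun z => ![A z, B z]) u := by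
    refine contDiffAt_pi.2 fun i => ?_
    fin_cases i
    · exact hu.1
    · exact hBu'
  refine ⟨hσ, ?_⟩
  ext i
  rw [Pi.add_apply, dbar_pi (hσ.differentiableAt (by simp))]
  fin_cases i
  · simpa [Matrix.mulVec, dotProduct] using hu.2
  · simpa [Matrix.mulVec, dotProduct] using dbar_eq_zero hBu.differentiableAt

theorem exists_analyticAt_of_poleOrder {h : ℂ → ℂ} {a : ℂ} (hh : MeromorphicAt h a) {p : ℕ}
    (hp : p = (-(meromorphicOrderAt h a).untop₀).toNat) :
    ∃ q : ℂ → ℂ, AnalyticAt ℂ q a ∧ (p = 0 ∨ q a ≠ 0) ∧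
      ∀ᶠ z in 𝓝[≠] a, h z = (z - a) ^ (-(p : ℤ)) * q z := by
  -- Order `⊤` means that `h` vanishes near `a`; there `untop₀` returns `0`, so `p = 0` and `q = 0`
  -- serves.
  rcases hm : meromorphicOrderAt h a with _ | m
  · refine ⟨0, analyticAt_const, Or.inl ?_, ?_⟩
    · rw [hp, hm]
      rfl
    · simpa using meromorphicOrderAt_eq_top_iff.1 hm
  · obtain ⟨q, hq, hqa, he⟩ := (meromorphicOrderAt_eq_int_iff hh).1 hm
    have hp' : p = (-m).toNat := by rw [hp, hm]; rfl
    rcases le_or_gt 0 m with h0 | h0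
    · obtain ⟨n, rfl⟩ := Int.eq_ofNat_of_zero_le h0
      have hp0 : p = 0 := by omega
      refine ⟨fun z => (z - a) ^ n * q z, by fun_prop, Or.inl hp0, ?_⟩
      filter_upwards [he] with z hz
      simp [hz, hp0]
    · refine ⟨q, hq, Or.inr hqa, ?_⟩
      filter_upwards [he] with z hz
      rw [hz, show -(p : ℤ) = m by omega, smul_eq_mul]

theorem hasOrderAt_psiTilde_coe {d₁ d₂ : ℤ} (η : DualForm (d₂ - d₁)) {f : OnePoint ℂ → ℂ}
    (hf : SmoothOnSphere f)
    (hfeq : ∀ z : ℂ, dbar (fun u : ℂ => f (u : OnePoint ℂ)) z = -η.coefN z)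
    {h : ℂ → ℂ} {a : ℂ} (hh : MeromorphicAt h a) :
    (extension d₁ d₂ η).HasOrderAt (psiTilde f h) (a : OnePoint ℂ)
      (-((-(meromorphicOrderAt h a).untop₀).toNat : ℤ)) := by
  refine ⟨fun b hb => ?_, fun hb => absurd hb (OnePoint.coe_ne_infty a)⟩
  obtain rfl : a = b := OnePoint.coe_injective hb
  obtain ⟨q, hq, hqa, he⟩ := exists_analyticAt_of_poleOrder hh rfl
  set p := (-(meromorphicOrderAt h a).untop₀).toNat
  have hpow : ∀ z : ℂ, DifferentiableAt ℂ (fun z : ℂ => (z - a) ^ p) z := fun z => by fun_prop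
  have hpc : ContDiff ℝ ∞ fun z : ℂ => (z - a) ^ p := (contDiff_id.sub contDiff_const).pow p
  refine ⟨fun z => ![(z - a) ^ p * f z + q z, (z - a) ^ p],
    holomorphicNear_extension (A := fun z => (z - a) ^ p * f z + q z)
      (B := fun z => (z - a) ^ p) ?_ (by fun_prop), fun h0 => ?_, ?_⟩
  · filter_upwards [hq.eventually_analyticAt] with u hu
    have hc1 : ContDiff ℝ ∞ fun z : ℂ => (z - a) ^ p * f z := hpc.mul hf.1
    refine ⟨hc1.contDiffAt.add ((hu.contDiffAt (n := ∞)).restrict_scalars ℝ), ?_⟩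
    rw [dbar_add (hc1.differentiable (by simp) u) (hu.differentiableAt.restrictScalars ℝ),
      dbar_holo_mul (p := fun z => (z - a) ^ p) (F := fun z : ℂ => f z) (hpow u)
        (hf.1.differentiable (by simp) u), dbar_eq_zero hu.differentiableAt, hfeq]
    ring
  -- At `a` the second component is `1` if `p = 0`; otherwise the first is `q a ≠ 0`.
  · have e0 := congrFun h0 0
    have e1 := congrFun h0 1
    rcases Nat.eq_zero_or_pos p with hp | hp
    · simp [hp] at e1
    · simp [hp.ne'] at e0
      exact (hqa.resolve_left hp.ne') e0
  · filter_upwards [he, self_mem_nhdsWithin] with z hz hza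
    have hza' : (z - a) ^ p ≠ 0 := pow_ne_zero _ (sub_ne_zero.2 hza)
    ext i
    fin_cases i <;> simp [psiTilde, hz, zpow_neg]
    · field_simp
    · field_simp

/-- Write `Q = P + ∑_{m<k} y v^m = w^n R` and `k = n + l`. Factoring `w^{d₁+n}` out leaves a vector
with second component `w^l` and first component `R` plus a multiple of `w^l`. Either `l = 0`, and
the second component is `1`, or `R(0) ≠ 0`. -/
theorem hasOrderAt_psiTilde_north {d₁ d₂ : ℤ} {k : ℕ} (hd : d₂ - d₁ = k) (η : DualForm (d₂ - d₁))
    {f : OnePoint ℂ → ℂ} {P : ℂ[X]} {U : ℂ → ℂ} (hU : ContDiff ℝ ∞ U)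
    (hdU : ∀ w, dbar U w = -η.coefS w) (hPU : ∀ w, f (ofW w) = P.eval w + w ^ k * U w)
    {y v : ℂ[X]} (hv : v.eval 0 = 0) {n : ℕ} (hnk : n ≤ k)
    (hn : ∀ j < n, (P + ∑ m ∈ Finset.range k, y * v ^ m).coeff j = 0)
    (hn' : n = k ∨ (P + ∑ m ∈ Finset.range k, y * v ^ m).coeff n ≠ 0) :
    (extension d₁ d₂ η).HasOrderAt (psiTilde f (hFun y v)) north (d₁ + n) := by
  refine ⟨fun b hb => absurd hb (OnePoint.infty_ne_coe b), fun _ => ?_⟩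
  obtain ⟨R, hR⟩ := Polynomial.X_pow_dvd_iff.2 hn
  obtain ⟨v', hv'⟩ := Polynomial.X_dvd_iff.2 ((Polynomial.coeff_zero_eq_eval_zero v).trans hv)
  obtain ⟨l, rfl⟩ := Nat.exists_eq_add_of_le hnk
  have hR0 : l = 0 ∨ R.eval 0 ≠ 0 := by
    rcases hn' with h | h
    · exact Or.inl (by omega)
    · rw [hR, Polynomial.coeff_X_pow_mul', if_pos le_rfl, Nat.sub_self,
        Polynomial.coeff_zero_eq_eval_zero] at h
      exact Or.inr h
  -- With `v = w v'`, the tail of the geometric series is `y v^k / (1 - v) = w^k y v'^k / (1 - v)`.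
  -- So `α` is the holomorphic part of `(f + h) / w^n`, the rest being `w^l U`.
  set α : ℂ → ℂ := fun w => R.eval w + w ^ l * (y.eval w * v'.eval w ^ (n + l) / (1 - v.eval w))
    with hα
  have hne : ∀ᶠ w in 𝓝 (0 : ℂ), 1 - v.eval w ≠ 0 :=
    (continuous_const.sub v.continuous).continuousAt.eventually_ne (by simp [hv])
  have hαa : AnalyticAt ℂ α 0 := by
    have hpoly : ∀ p : ℂ[X], AnalyticAt ℂ (fun w => p.eval w) 0 := fun p =>
      p.differentiable.analyticAt 0
    exact (hpoly R).add ((analyticAt_id.pow l).mul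
      (((hpoly y).mul ((hpoly v').pow _)).div (analyticAt_const.sub (hpoly v)) (by simp [hv])))
  have hlU : ContDiff ℝ ∞ fun w : ℂ => w ^ l * U w := (contDiff_id.pow l).mul hU
  refine ⟨fun w => ![w ^ l * U w + α w, w ^ l],
    holomorphicNear_extension (A := fun w => w ^ l * U w + α w)
      (B := fun w => w ^ l) ?_ (by fun_prop), fun h0 => ?_, ?_⟩
  · filter_upwards [hαa.eventually_analyticAt] with u hu
    refine ⟨hlU.contDiffAt.add ((hu.contDiffAt (n := ∞)).restrict_scalars ℝ), ?_⟩
    rw [dbar_add (hlU.differentiable (by simp) u) (hu.differentiableAt.restrictScalars ℝ),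
      dbar_holo_mul (p := fun z => z ^ l) (by fun_prop)
        (hU.differentiable (by simp) u), dbar_eq_zero hu.differentiableAt, hdU]
    ring
  · have e0 := congrFun h0 0
    have e1 := congrFun h0 1
    rcases Nat.eq_zero_or_pos l with hl | hl
    · simp [hl] at e1
    · simp [hl.ne', hα] at e0
      exact (hR0.resolve_left hl.ne') e0
  · filter_upwards [hne.filter_mono nhdsWithin_le_nhds, self_mem_nhdsWithin] with w hw hw0
    have hw0 : w ≠ 0 := hw0
    have hRw := congrArg (Polynomial.eval w) hR
    simp only [Polynomial.eval_add, Polynomial.eval_finsetSum, Polynomial.eval_mul,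
      Polynomial.eval_pow, Polynomial.eval_X, ← Finset.mul_sum] at hRw
    have hvw : v.eval w = w * v'.eval w := by
      rw [hv', Polynomial.eval_mul, Polynomial.eval_X]
    have hgeom := mul_neg_geom_sum (v.eval w) (n + l)
    have hh : y.eval w / (1 - v.eval w) = y.eval w * ∑ m ∈ Finset.range (n + l), v.eval w ^ m +
        w ^ n * w ^ l * (y.eval w * v'.eval w ^ (n + l) / (1 - v.eval w)) := by
      have : v.eval w ^ (n + l) = w ^ n * w ^ l * v'.eval w ^ (n + l) := by
        rw [hvw, mul_pow, pow_add w]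
      field_simp
      linear_combination (-y.eval w) * hgeom + y.eval w * this
    have hd₂ : d₂ = d₁ + n + l := by push_cast at hd; omega
    have hmain : f (ofW w) + y.eval w / (1 - v.eval w) = w ^ n * (w ^ l * U w + α w) := by
      rw [hPU, hh, hα, pow_add]
      linear_combination hRw
    have hmain' : f ((w⁻¹ : ℂ) : OnePoint ℂ) + hFun y v w⁻¹ = w ^ n * (w ^ l * U w + α w) := by
      rw [← hmain, ofW_of_ne hw0, hFun, inv_inv]
    ext i
    fin_cases i
    · simp [extension, psiTilde, Matrix.mulVec, dotProduct, hmain', zpow_add₀ hw0]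
      ring
    · simp [extension, psiTilde, Matrix.mulVec, dotProduct, hd₂, zpow_add₀ hw0]

/-! ### The expansion and the poles of `h` -/

/-- Since `y` and `v` vanish at `0`, `w^{m+1}` divides `y v^m`, so terms with `m ≥ j` do not reach
degree `j`. One polynomial, truncated at `k`, thus encodes all the equations. -/
theorem coeff_sum_mul_pow {y v : ℂ[X]} (hy : y.eval 0 = 0) (hv : v.eval 0 = 0) {j k : ℕ}
    (hjk : j ≤ k) : (∑ m ∈ Finset.range k, y * v ^ m).coeff j =
      ∑ m ∈ Finset.range j, (y * v ^ m).coeff j := by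
  rw [Polynomial.finsetSum_coeff]
  refine (Finset.sum_subset (Finset.range_mono hjk) fun m _ hm => ?_).symm
  have h1 : Polynomial.X ∣ y :=
    Polynomial.X_dvd_iff.2 ((Polynomial.coeff_zero_eq_eval_zero y).trans hy)
  have h2 : Polynomial.X ∣ v :=
    Polynomial.X_dvd_iff.2 ((Polynomial.coeff_zero_eq_eval_zero v).trans hv)
  have h3 : Polynomial.X ^ (m + 1) ∣ y * v ^ m := by
    rw [pow_succ']
    exact mul_dvd_mul h1 (pow_dvd_pow_of_dvd h2 m)
  exact Polynomial.X_pow_dvd_iff.1 h3 j (by simpa [Nat.lt_succ_iff] using hm)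

theorem meromorphicAt_hFun (y v : ℂ[X]) (a : ℂ) : MeromorphicAt (hFun y v) a := by
  have hinv : MeromorphicAt (fun z : ℂ => z⁻¹) a := (MeromorphicAt.id a).inv
  have hp : ∀ p : ℂ[X], MeromorphicAt (fun z : ℂ => p.eval z⁻¹) a := fun p => by
    simp only [Polynomial.eval_eq_sum_range]
    exact MeromorphicAt.fun_sum fun i _ => (MeromorphicAt.const _ a).mul (hinv.pow i)
  exact (hp y).div ((MeromorphicAt.const 1 a).sub (hp v))

/-- Off `z = 0` and the inverses of the roots of the nonzero polynomial `1 - v`, the function `h` is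
analytic. Finiteness makes the divisor a `Finsupp` and the `finsum` in `poleCount` a genuine sum. -/
theorem finite_poles_hFun (y : ℂ[X]) {v : ℂ[X]} (hv : v.eval 0 = 0) :
    (Function.support fun a : ℂ =>
      (((-(meromorphicOrderAt (hFun y v) a).untop₀).toNat : ℕ) : ℤ)).Finite := by
  have hv1 : 1 - v ≠ 0 := fun h => by
    have := congrArg (Polynomial.eval 0) h
    simp [hv] at this
  have hfin : ({0} ∪ (fun z : ℂ => z⁻¹) ⁻¹' {z | (1 - v).IsRoot z}).Finite :=
    (Set.finite_singleton 0).union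
      ((Polynomial.finite_setOfPred_isRoot hv1).preimage inv_injective.injOn)
  refine hfin.subset fun a ha => ?_
  by_contra hna
  simp only [Set.mem_union, Set.mem_singleton_iff, Set.mem_preimage, Set.mem_ofPred_eq,
    Polynomial.IsRoot, not_or, Polynomial.eval_sub, Polynomial.eval_one] at hna
  have hp : ∀ p : ℂ[X], AnalyticAt ℂ (fun z : ℂ => p.eval z⁻¹) a := fun p =>
    (p.differentiable.analyticAt a⁻¹).comp (analyticAt_id.inv hna.1)
  have han : AnalyticAt ℂ (hFun y v) a := (hp y).div (analyticAt_const.sub (hp v)) hna.2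
  refine ha ?_
  have := han.meromorphicOrderAt_nonneg
  simp only [Nat.cast_eq_zero, Int.toNat_eq_zero, Left.neg_nonpos_iff]
  exact WithTop.untop₀_nonneg.2 this

end SphereExt

end

/-! ### The degree formula -/

open SphereExt
theorem mainTheorem7 (d₁ d₂ : ℤ) (hL : 2 ≤ d₂ - d₁)
    (H : HermitianMetric (d₂ - d₁)) (g : Polynomial ℂ)
    (hg : (g.natDegree : ℤ) ≤ d₂ - d₁ - 2)
    (f : OnePoint ℂ → ℂ) (hf : SmoothOnSphere f) (hfN : f north = 0)
    (hfeq : ∀ z : ℂ, dbar (fun u : ℂ => f (u : OnePoint ℂ)) z =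
      -(starRingEnd ℂ (g.eval z) * (H.normSqN z : ℂ)))
    (y v : Polynomial ℂ) (hy : y.eval 0 = 0) (hv : v.eval 0 = 0) (hyv : IsCoprime y (1 - v))
    (jstar : ℕ)
    (hj : IsGreatest {n : ℕ | (n : ℤ) ≤ d₂ - d₁ ∧ ∀ j : ℕ, 1 ≤ j → j < n → SystemEq H g y v j}
      jstar) :
    (extension d₁ d₂ (antiholForm H g hg)).HasDegree (psiTilde f (hFun y v))
      (d₁ + jstar - poleCount (hFun y v)) := by
  obtain ⟨k, hk⟩ : ∃ k : ℕ, d₂ - d₁ = k := ⟨(d₂ - d₁).toNat, by omega⟩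
  have hfeq' : ∀ z : ℂ, dbar (fun u : ℂ => f (u : OnePoint ℂ)) z =
      -(antiholForm H g hg).coefN z := hfeq
  obtain ⟨P, U, hU, hPU, hdU⟩ := exists_polynomial_add_pow_mul k hf.2
    (antiholForm H g hg).smoothS.neg (dbar_comp_ofW hk _ hf hfeq')
  have hcoeff : ∀ j : ℕ, 1 ≤ j → j < k →
      ((P + ∑ m ∈ Finset.range k, y * v ^ m).coeff j = 0 ↔ SystemEq H g y v j) := by
    intro j h1 h2
    rw [Polynomial.coeff_add, coeff_sum_mul_pow hy hv h2.le,
      coeff_eq_neg_bCoeff hk H g hg hf hfeq' hU.continuous hPU h1 h2, neg_add_eq_zero, SystemEq]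
  -- The system says nothing about degree `0`; there the normalisation `f(N) = 0` is what is needed.
  have hcoeff0 : (P + ∑ m ∈ Finset.range k, y * v ^ m).coeff 0 = 0 := by
    have h := hPU 0
    rw [ofW, if_pos rfl, hfN, zero_pow (by omega), zero_mul, add_zero] at h
    rw [Polynomial.coeff_add, coeff_sum_mul_pow hy hv (Nat.zero_le k),
      Polynomial.coeff_zero_eq_eval_zero, ← h]
    simp
  obtain ⟨⟨hjk, hsys⟩, hmax⟩ := hj
  have hjk' : jstar ≤ k := by omega
  have hnorth := hasOrderAt_psiTilde_north hk (antiholForm H g hg) hU hdU hPU (y := y) hv hjk'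
    (fun j hjlt => by
      rcases Nat.eq_zero_or_pos j with rfl | h1
      · exact hcoeff0
      · exact (hcoeff j h1 (by omega)).2 (hsys j h1 hjlt))
    (by
      -- If `j^* < k` and the coefficient of degree `j^*` vanished, the equation for `j^*` would
      -- also hold and `j^* + 1` would be admissible, against maximality.
      by_contra! hcon
      have hmem : jstar + 1 ∈ {n : ℕ | (n : ℤ) ≤ d₂ - d₁ ∧
          ∀ j : ℕ, 1 ≤ j → j < n → SystemEq H g y v j} := by
        refine ⟨by have := hcon.1; omega, fun j h1 h2 => ?_⟩
        rcases Nat.lt_succ_iff_lt_or_eq.1 h2 with h | rfl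
        · exact hsys j h1 h
        · exact (hcoeff j h1 (by have := hcon.1; omega)).1 hcon.2
      exact absurd (hmax hmem) (by omega))
  let c : ℂ →₀ ℤ := Finsupp.ofSupportFinite _ (finite_poles_hFun y hv)
  let ι : ℂ ↪ OnePoint ℂ := ⟨fun a => (a : OnePoint ℂ), OnePoint.coe_injective⟩
  -- The divisor is `(d₁ + j^*) N` minus the divisor of the finite poles of `h`. Finite zeros of `f
  -- + h` do not enter, because the second component is `1`.
  refine ⟨Finsupp.single north (d₁ + jstar) - c.embDomain ι, fun x => ?_, ?_⟩
  · induction x using OnePoint.rec with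
    | infty =>
      have h0 : c.embDomain ι OnePoint.infty = 0 :=
        Finsupp.embDomain_of_notMem_range _ _ _ (by rintro ⟨a, ha⟩; exact OnePoint.coe_ne_infty a ha)
      rw [Finsupp.sub_apply, h0, sub_zero, show OnePoint.infty = north from rfl,
        Finsupp.single_eq_same]
      exact hnorth
    | coe a =>
      have h0 : c.embDomain ι (a : OnePoint ℂ) = c a := Finsupp.embDomain_apply_self ι c a
      rw [Finsupp.sub_apply, h0, Finsupp.single_eq_of_ne (show (a : OnePoint ℂ) ≠ north from
        OnePoint.coe_ne_infty a), zero_sub]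
      exact hasOrderAt_psiTilde_coe _ hf hfeq' (meromorphicAt_hFun y v a)
  · rw [Finsupp.sum_sub_index (fun _ _ _ => rfl), Finsupp.sum_single_index rfl,
      Finsupp.sum_embDomain]
    congr 1
    rw [poleCount, finsum_eq_sum_of_support_subset (s := c.support) _ ?_, Finsupp.sum]
    · push_cast
      rfl
    · intro a ha
      simpa [c, Finsupp.ofSupportFinite_coe] using ha
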